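/- A source always has a packet to send; time is slotted. A relay R has an infinite data buffer holding $q_d\in\{0,1,2,\dots\}$ packets and an energy buffer holding $q_e\in\{0,\dots,N\}$ units. Let $\Gamma\in\{0,\dots,b_{\max}\}$ be the number of energy units harvestable in a slot, let $p_S\in[0,1)$ and $p_R\in[0,1]$ be the detection probabilities of the source–destination and relay–destination links, and assume $K\ge 1$, $b_{\max}\le K$ and $N\ge 2K$. A dynamic policy $\{\alpha_s\}$ selects, in state $s=(q_d,q_e)$ at the beginning of a slot, the decoding (DD) mode with probability $\alpha_s$ and the energy harvesting (EH) mode with probability $1-\alpha_s$. In the first subslot the source transmits, and the destination detects its packet with probability $p_S$. In DD mode R stores the packet if the destination did not detect it; in EH mode $q_e$ becomes $\min(q_e+\Gamma,N)$, and the units exceeding $N$ are blocked. In the second subslot R is active, i.e. it transmits its head-of-line packet and spends $K$ energy units, exactly when it then has at least one packet and at least $K$ energy units; the packet leaves with probability $p_R$ (if detected by the destination) and otherwise stays. All mode choices, harvests and detections are independent. The throughput is the long-run expected number of packets detected at the destination per slot (in a stationary regime, $p_S+p_R\Pr\{\text{R active}\}$). Put $$\alpha^T=\frac{E(\Gamma)\,p_R}{E(\Gamma)\,p_R+K(1-p_S)}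 .$$ For an integer $e_{th}\le N-b_{\max}+1$ consider a dynamic policy with $$\alpha^T_s=\begin{cases}1, & s=(0,q_e),\ q_e\ge e_{th},\\ 0, & s=(0,q_e),\ q_e<e_{th},\\ 0, & s=(1,q_e),\ 0\le q_e\le N.\end{cases}$$ Then: (i) started with at most one packet at R, the system never has more than one packet at R at the beginning of a slot, and the policy is throughput-optimal: the lower limit of its expected throughput over the first $n$ slots is at least the upper limit of that of any dynamic policy with any initial law; (ii) started with $q_d=0$, almost surely no energy unit is ever blocked; (iii) there is a stationary law $p$ of the state carried by $\{q_d\le1\}$, and for every such law no energy unit is blocked almost surely, the blocking probability (the expected fraction of blocked energy units among those offered to the buffer) is $0$, and the average decoding probability is $\overline{\alpha^T_s}=\sum_s p_s\alpha^T_s=\alpha^T$. -/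

import Mathlib

open Filter
open scoped ENNReal

noncomputable section

namespace Relay

/-- Parameters of the slotted source-relay-destination network: the size `N` of the energy
buffer, the number `K` of energy units spent on one transmission of the relay, the law `harvest`
of the number `Γ ∈ {0, …, bmax}` of energy units harvestable in a slot, and the detection
probabilities `pS` (source to destination) and `pR` (relay to destination). -/
structure Network where
  /-- size of the energy buffer -/
  N : ℕ
  /-- energy units per relay transmission -/
  K : ℕ
  /-- maximal number of energy units harvested in a slot -/
  bmax : ℕ
  /-- detection probability of the source-destination link -/
  pS : unitInterval
  /-- detection probability of the relay-destination link -/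
  pR : unitInterval
  /-- law of the number of energy units harvested in a slot of the EH mode -/
  harvest : PMF (Fin (bmax + 1))

/-- The law of a random bit that is `true` with probability `p`. -/
def coin (p : unitInterval) : PMF Bool :=
  PMF.ofFintype (fun b => cond b (ENNReal.ofReal (p : ℝ)) (ENNReal.ofReal (1 - (p : ℝ)))) (by
    have h0 : (0 : ℝ) ≤ p := p.2.1
    have h1 : (0 : ℝ) ≤ 1 - (p : ℝ) := sub_nonneg.2 p.2.2
    simp [← ENNReal.ofReal_add h0 h1])

/-- Expectation of a real function under a discrete law. It is only applied to bounded
functions, for which the series converges absolutely. -/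
def expect {A : Type*} (μ : PMF A) (f : A → ℝ) : ℝ :=
  ∑' a, (μ a).toReal * f a

namespace Network

variable (R : Network)

/-- The mean `E(Γ)` of the energy harvestable in a slot. -/
def meanHarvest : ℝ :=
  expect R.harvest fun g => ((g : ℕ) : ℝ)

/-- The decoding probability
`α^T = E(Γ) pR / (E(Γ) pR + K (1 - pS))`. -/
def alphaT : ℝ :=
  R.meanHarvest * (R.pR : ℝ) / (R.meanHarvest * (R.pR : ℝ) + (R.K : ℝ) * (1 - (R.pS : ℝ)))

/-- System state `(q_d, q_e)` at the beginning of a slot: the data buffer is infinite, the energy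
buffer holds at most `N` units. -/
abbrev State : Type := ℕ × Fin (R.N + 1)

/-- A dynamic policy `{α_s}`: the probability of selecting the DD mode, as a function of the
current state. -/
abbrev Policy : Type := R.State → unitInterval

/-- The random choices made in a slot: whether the DD mode is selected, the number of harvestable
energy units, whether the source transmission is detected at the destination, and whether a
transmission of the relay (if there is one) is detected at the destination. -/
abbrev Draw : Type := Bool × Fin (R.bmax + 1) × Bool × Bool

/-- A slot: the state at its beginning and the random choices made in it. -/
abbrev Slot : Type := R.State × R.Draw

/-- Given the state, the mode, the harvest and the two detections are independent. -/
def drawLaw (α : R.Policy) (s : R.State) : PMF R.Draw :=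
  (coin (α s)).bind fun m => R.harvest.bind fun g => (coin R.pS).bind fun a =>
    (coin R.pR).map fun b => (m, g, a, b)

variable {R}

namespace Slot

/-- `q_d` at the beginning of the slot. -/
def qd (w : R.Slot) : ℕ := w.1.1

/-- `q_e` at the beginning of the slot. -/
def qe (w : R.Slot) : Fin (R.N + 1) := w.1.2

/-- The relay is in the DD mode; otherwise it is in the EH mode. -/
def decoding (w : R.Slot) : Bool := w.2.1

/-- The number of harvestable energy units. -/
def energy (w : R.Slot) : ℕ := w.2.2.1

/-- The source transmission is detected at the destination. -/
def directOK (w : R.Slot) : Bool := w.2.2.2.1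

/-- A transmission of the relay in this slot would be detected at the destination. -/
def relayOK (w : R.Slot) : Bool := w.2.2.2.2

/-- Data packets at the relay after the first subslot: in the DD mode the packet of the source
is stored if the destination has not detected it. -/
def midQd (w : R.Slot) : ℕ :=
  if decoding w && !directOK w then qd w + 1 else qd w

/-- Energy units after the first subslot: in the EH mode the harvest is added, as far as the
buffer has room for it. -/
def midQe (w : R.Slot) : Fin (R.N + 1) :=
  if decoding w then qe w
  else ⟨min ((qe w : ℕ) + energy w) R.N, Nat.lt_succ_of_le (min_le_right _ _)⟩

/-- The relay is active: at the beginning of the second subslot it has a packet and at least `K`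
energy units. It then transmits. -/
def active (w : R.Slot) : Prop :=
  1 ≤ midQd w ∧ R.K ≤ (midQe w : ℕ)

instance (w : R.Slot) : Decidable (active w) := inferInstanceAs (Decidable (_ ∧ _))

/-- The state at the beginning of the next slot: an active relay spends `K` energy units, and its
head-of-line packet leaves if the transmission is detected. -/
def next (w : R.Slot) : R.State :=
  if active w then
    (if relayOK w then midQd w - 1 else midQd w,
      ⟨(midQe w : ℕ) - R.K, lt_of_le_of_lt (Nat.sub_le _ _) (midQe w).2⟩)
  else (midQd w, midQe w)

/-- The number of packets detected at the destination in the slot. -/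
def delivered (w : R.Slot) : ℕ :=
  (if directOK w then 1 else 0) + (if active w ∧ relayOK w = true then 1 else 0)

/-- The number of energy units offered to the energy buffer (none in the DD mode). -/
def offered (w : R.Slot) : ℕ :=
  if decoding w then 0 else energy w

/-- The number of offered energy units that are blocked because the energy buffer is full
(truncated subtraction: the part of `q_e + Γ` above `N`). -/
def blocked (w : R.Slot) : ℕ :=
  ((qe w : ℕ) + offered w) - R.N

end Slot

/-- The joint law of the state and the random choices of a slot, when `μ` is the law of the
state. -/
def slotLaw (α : R.Policy) (μ : PMF R.State) : PMF R.Slot :=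
  μ.bind fun s => (R.drawLaw α s).map fun d => (s, d)

/-- One step of the Markov chain of system states, acting on laws. -/
def step (α : R.Policy) (μ : PMF R.State) : PMF R.State :=
  (slotLaw α μ).map Slot.next

/-- The law of the state at the beginning of slot `t`, for the initial law `μ`. -/
def law (α : R.Policy) (μ : PMF R.State) (t : ℕ) : PMF R.State :=
  (step α)^[t] μ

/-- `μ` is a stationary law of the system state under the policy `α`. -/
def IsStationary (α : R.Policy) (μ : PMF R.State) : Prop :=
  step α μ = μ

/-- The relay holds at most `m` data packets under the law `μ`. -/
def AtMost (m : ℕ) (μ : PMF R.State) : Prop :=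
  ∀ s ∈ μ.support, s.1 ≤ m

/-- The expected number of packets detected at the destination per slot, over the first `n`
slots. For a stationary initial law it is, for every `n ≥ 1`, the probability `pS` of a direct
detection plus `pR` times the probability of an active relay. -/
def avgThroughput (α : R.Policy) (μ : PMF R.State) (n : ℕ) : ℝ :=
  (∑ t ∈ Finset.range n, expect (slotLaw α (law α μ t)) fun w => (Slot.delivered w : ℝ)) / n

/-- The policy `α`, started in the law `μ`, is throughput-optimal among dynamic policies: its
long-run throughput (in the sense of the lower limit) is at least that of every dynamic policy
with every initial law (in the sense of the upper limit). -/
def IsThroughputOptimal (α : R.Policy) (μ : PMF R.State) : Prop :=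
  ∀ (α' : R.Policy) (μ' : PMF R.State),
    limsup (avgThroughput α' μ') atTop ≤ liminf (avgThroughput α μ) atTop

/-- The average decoding probability `∑ p_s α_s`. -/
def avgDecoding (α : R.Policy) (μ : PMF R.State) : ℝ :=
  expect μ fun s => (α s : ℝ)

/-- The blocking probability of the energy buffer: the fraction of offered energy units that are
blocked, when `μ` is the stationary law of the state. -/
def blockingProb (α : R.Policy) (μ : PMF R.State) : ℝ :=
  expect (slotLaw α μ) (fun w => (Slot.blocked w : ℝ)) /
    expect (slotLaw α μ) (fun w => (Slot.offered w : ℝ))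

/-- The threshold policy: with an empty data buffer the relay decodes exactly when
`q_e ≥ e_th`, and with one packet it always harvests. The mode selection with two or more packets
is left arbitrary. -/
def IsThresholdPolicy (eth : ℤ) (α : R.Policy) : Prop :=
  (∀ q : Fin (R.N + 1), eth ≤ ((q : ℕ) : ℤ) → α (0, q) = 1) ∧
  (∀ q : Fin (R.N + 1), ((q : ℕ) : ℤ) < eth → α (0, q) = 0) ∧
  (∀ q : Fin (R.N + 1), α (1, q) = 0)

end Network

end Relay

end

/-!
Throughout, `m = E(Γ)`, and a slot is analysed conditionally on its initial state `s`, where all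
expectations are finite sums. If `A` is the conditional probability of an active relay and `B` the
conditional mean of the blocked energy, then the data buffer drifts by `α_s (1 - pS) - pR A` and
the energy buffer by `(1 - α_s) m - B - K A`.

Two linear combinations of these drifts carry the proof.

* The combination `m q_d + (1 - pS) q_e` eliminates `α_s`. Scaled to the `potential` `Φ`, it gives
  an average-reward equation valid for every policy (`slotExpect_delivered_add_potential`): expected
  deliveries plus `E Φ(next)` equal `T + Φ(s) - c B` with a constant `T` (`optThroughput`) and
  `c ≥ 0`. Since `Φ ≥ 0` and `B ≥ 0`, a policy started in `s` delivers at most `n T + Φ(s)` packets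
  on average in `n` slots (`value_le`). Under the threshold policy `Φ` stays bounded and, after one
  slot, `B = 0`, so that it delivers at least `n T - C`. An initial law may give `Φ` infinite mean;
  the upper bound is then passed to the limit by dominated convergence, because at most two packets
  are delivered per slot (`limsup_avgThroughput_le`).
* The combination `K q_d - pR q_e` eliminates `A`. In a stationary regime without blocking its mean
  drift is `0`, which is a linear equation for the average decoding probability with the solution
  `α^T` (`avgDecoding_eq_alphaT`).

No energy is blocked because the set `HasRoom` of states is absorbing, and is reached in one slot
from any state with at most one packet: a relay that is left with a packet has either just spent
`K ≥ bmax` units, or holds fewer than `K ≤ N - bmax`; and with an empty data buffer it harvests only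
below the threshold. A stationary law exists because the chain on the finite set `{q_d ≤ 1}` has a
stochastic transition matrix.
-/

namespace Relay

/-! ### Expectations under discrete laws -/

section Expect

variable {A B : Type*}

theorem expect_eq_sum [Fintype A] (μ : PMF A) (f : A → ℝ) :
    expect μ f = ∑ a, (μ a).toReal * f a :=
  tsum_fintype _

theorem summable_pmf_toReal (μ : PMF A) : Summable fun a => (μ a).toReal :=
  ENNReal.summable_toReal (by simp [μ.tsum_coe])

theorem tsum_pmf_toReal (μ : PMF A) : ∑' a, (μ a).toReal = 1 := by
  rw [← ENNReal.tsum_toReal_eq fun a => μ.apply_ne_top a, μ.tsum_coe, ENNReal.toReal_one]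

theorem expect_summable (μ : PMF A) {f : A → ℝ} {C : ℝ} (hf : ∀ a, |f a| ≤ C) :
    Summable fun a => (μ a).toReal * f a := by
  refine Summable.of_norm_bounded ((summable_pmf_toReal μ).mul_right C) fun a => ?_
  rw [Real.norm_eq_abs, abs_mul, abs_of_nonneg ENNReal.toReal_nonneg]
  exact mul_le_mul_of_nonneg_left (hf a) ENNReal.toReal_nonneg

theorem expect_const (μ : PMF A) (c : ℝ) : expect μ (fun _ => c) = c := by
  rw [expect, tsum_mul_right, tsum_pmf_toReal, one_mul]

theorem expect_congr (μ : PMF A) {f g : A → ℝ} (h : ∀ a ∈ μ.support, f a = g a) :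
    expect μ f = expect μ g := by
  refine tsum_congr fun a => ?_
  by_cases ha : a ∈ μ.support
  · rw [h a ha]
  · rw [μ.apply_eq_zero_iff a |>.2 ha]
    simp

theorem expect_mono (μ : PMF A) {f g : A → ℝ} {C D : ℝ} (hf : ∀ a, |f a| ≤ C)
    (hg : ∀ a, |g a| ≤ D) (h : ∀ a ∈ μ.support, f a ≤ g a) : expect μ f ≤ expect μ g := by
  refine (expect_summable μ hf).tsum_le_tsum (fun a => ?_) (expect_summable μ hg)
  by_cases ha : a ∈ μ.support
  · exact mul_le_mul_of_nonneg_left (h a ha) ENNReal.toReal_nonneg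
  · rw [μ.apply_eq_zero_iff a |>.2 ha]
    simp

theorem expect_add (μ : PMF A) {f g : A → ℝ} {C D : ℝ} (hf : ∀ a, |f a| ≤ C)
    (hg : ∀ a, |g a| ≤ D) : expect μ (fun a => f a + g a) = expect μ f + expect μ g := by
  simp only [expect, mul_add]
  exact (expect_summable μ hf).tsum_add (expect_summable μ hg)

theorem expect_const_mul (μ : PMF A) (c : ℝ) (f : A → ℝ) :
    expect μ (fun a => c * f a) = c * expect μ f := by
  simp only [expect, mul_left_comm _ c]
  exact tsum_mul_left

theorem expect_pure (a : A) (f : A → ℝ) : expect (PMF.pure a) f = f a := by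
  rw [expect, tsum_eq_single a fun b hb => by simp [hb]]
  simp

theorem expect_bind (μ : PMF A) (κ : A → PMF B) {f : B → ℝ} {C : ℝ} (hf : ∀ b, |f b| ≤ C) :
    expect (μ.bind κ) f = expect μ fun a => expect (κ a) f := by
  have h1 : Summable fun x : A × B => (μ x.1 * κ x.1 x.2).toReal := by
    refine ENNReal.summable_toReal ?_
    rw [ENNReal.tsum_prod' (f := fun x : A × B => μ x.1 * κ x.1 x.2)]
    simp [ENNReal.tsum_mul_left, PMF.tsum_coe]
  have h2 : Summable fun x : A × B => (μ x.1 * κ x.1 x.2).toReal * f x.2 := by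
    refine Summable.of_norm_bounded (h1.mul_right C) fun x => ?_
    rw [Real.norm_eq_abs, abs_mul, abs_of_nonneg ENNReal.toReal_nonneg]
    exact mul_le_mul_of_nonneg_left (hf _) ENNReal.toReal_nonneg
  calc expect (μ.bind κ) f = ∑' b, ∑' a, (μ a * κ a b).toReal * f b := by
        refine tsum_congr fun b => ?_
        rw [PMF.bind_apply, ENNReal.tsum_toReal_eq, tsum_mul_right]
        exact fun a => ENNReal.mul_ne_top (μ.apply_ne_top a) ((κ a).apply_ne_top b)
    _ = ∑' a, ∑' b, (μ a * κ a b).toReal * f b :=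
        Summable.tsum_comm (f := fun a b => (μ a * κ a b).toReal * f b) h2
    _ = expect μ fun a => expect (κ a) f := by
        refine tsum_congr fun a => ?_
        simp only [expect, ENNReal.toReal_mul, mul_assoc, tsum_mul_left]

theorem expect_map (μ : PMF A) (g : A → B) {f : B → ℝ} {C : ℝ} (hf : ∀ b, |f b| ≤ C) :
    expect (μ.map g) f = expect μ fun a => f (g a) := by
  rw [← PMF.bind_pure_comp, expect_bind _ _ hf]
  simp only [Function.comp_apply, expect_pure]

theorem exists_abs_le [Finite A] (f : A → ℝ) : ∃ C, ∀ a, |f a| ≤ C := by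
  obtain ⟨C, hC⟩ := (Set.finite_range fun a => |f a|).bddAbove
  exact ⟨C, fun a => hC ⟨a, rfl⟩⟩

theorem expect_coin (p : unitInterval) (f : Bool → ℝ) :
    expect (coin p) f = p * f true + (1 - p) * f false := by
  have h0 : (0 : ℝ) ≤ p := p.2.1
  have h1 : (0 : ℝ) ≤ 1 - (p : ℝ) := sub_nonneg.2 p.2.2
  simp [expect_eq_sum, coin, ENNReal.toReal_ofReal h0, ENNReal.toReal_ofReal h1]

/-- Dominated convergence for expectations of uniformly bounded functions. -/
theorem tendsto_expect (μ : PMF A) {f : ℕ → A → ℝ} {g : A → ℝ} {C : ℝ}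
    (hf : ∀ n a, |f n a| ≤ C) (h : ∀ a, Tendsto (fun n => f n a) atTop (nhds (g a))) :
    Tendsto (fun n => expect μ (f n)) atTop (nhds (expect μ g)) := by
  refine tendsto_tsum_of_dominated_convergence ((summable_pmf_toReal μ).mul_right C)
    (fun a => (h a).const_mul _) (Eventually.of_forall fun n a => ?_)
  rw [Real.norm_eq_abs, abs_mul, abs_of_nonneg ENNReal.toReal_nonneg]
  exact mul_le_mul_of_nonneg_left (hf n a) ENNReal.toReal_nonneg

end Expect

/-! ### Stationary laws of finite Markov chains -/

/-- A nonzero left fixed vector of a stochastic matrix exists because the constant vector is a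
right one; its absolute value is again fixed, since `|v| ≤ |v| P` and both sides have the same
total mass. -/
theorem exists_nonneg_fixed_vector {ι : Type*} [Fintype ι] [DecidableEq ι] [Nonempty ι]
    (P : ι → ι → ℝ) (hP : ∀ i j, 0 ≤ P i j) (hsum : ∀ i, ∑ j, P i j = 1) :
    ∃ w : ι → ℝ, (∀ i, 0 ≤ w i) ∧ ∑ i, w i = 1 ∧ ∀ j, ∑ i, w i * P i j = w j := by
  have hdet : (Matrix.of P - 1 : Matrix ι ι ℝ).det = 0 := by
    refine Matrix.exists_mulVec_eq_zero_iff.1 ⟨fun _ => 1, ?_, ?_⟩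
    · exact fun h => one_ne_zero (congrFun h (Classical.arbitrary ι))
    · ext i
      simp [Matrix.mulVec, dotProduct, hsum, Matrix.one_apply]
  obtain ⟨v, hv0, hv⟩ := Matrix.exists_vecMul_eq_zero_iff.2 hdet
  have hfix : ∀ j, ∑ i, v i * P i j = v j := fun j => by
    have := congrFun hv j
    rw [Matrix.vecMul_sub, Matrix.vecMul_one] at this
    simpa [Matrix.vecMul, dotProduct, sub_eq_zero] using this
  have hle : ∀ j ∈ Finset.univ, |v j| ≤ ∑ i, |v i| * P i j := fun j _ => by
    calc |v j| = |∑ i, v i * P i j| := by rw [hfix]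
      _ ≤ ∑ i, |v i * P i j| := Finset.abs_sum_le_sum_abs _ _
      _ = ∑ i, |v i| * P i j := by simp [abs_mul, abs_of_nonneg (hP _ _)]
  have htot : ∑ j, |v j| = ∑ j, ∑ i, |v i| * P i j := by
    rw [Finset.sum_comm]
    simp [← Finset.mul_sum, hsum]
  have heq := (Finset.sum_eq_sum_iff_of_le hle).1 htot
  have hpos : 0 < ∑ i, |v i| := by
    obtain ⟨i, hi⟩ := Function.ne_iff.1 hv0
    exact Finset.sum_pos' (fun _ _ => abs_nonneg _) ⟨i, Finset.mem_univ i, abs_pos.2 hi⟩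
  refine ⟨fun i => |v i| / ∑ i, |v i|, fun i => by positivity, ?_, fun j => ?_⟩
  · rw [← Finset.sum_div, div_self hpos.ne']
  · simp only [div_mul_eq_mul_div]
    rw [← Finset.sum_div, ← heq j (Finset.mem_univ j)]

theorem exists_stationary_of_finset {A : Type*} (κ : A → PMF A) (S : Finset A) (hS : S.Nonempty)
    (hκ : ∀ a ∈ S, ∀ b ∈ (κ a).support, b ∈ S) :
    ∃ μ : PMF A, (∀ a ∈ μ.support, a ∈ S) ∧ μ.bind κ = μ := by
  classical
  have hzero : ∀ a ∈ S, ∀ b, b ∉ S → κ a b = 0 := fun a ha b hb =>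
    ((κ a).apply_eq_zero_iff b).2 fun h => hb (hκ a ha b h)
  have : Nonempty S := hS.to_subtype
  obtain ⟨w, hw0, hw1, hw⟩ := exists_nonneg_fixed_vector (fun i j : S => (κ i j).toReal)
    (fun _ _ => ENNReal.toReal_nonneg) fun i => by
      rw [← tsum_pmf_toReal (κ i), Finset.sum_coe_sort S fun j => (κ i j).toReal]
      refine (tsum_eq_sum fun b hb => ?_).symm
      rw [hzero i i.2 b hb, ENNReal.toReal_zero]
  let f : A → ℝ≥0∞ := fun a => if h : a ∈ S then ENNReal.ofReal (w ⟨a, h⟩) else 0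
  have hf : ∀ i : S, f i = ENNReal.ofReal (w i) := fun i => by simp [f]
  have hf0 : ∀ a ∉ S, f a = 0 := fun a ha => by simp [f, ha]
  have hf1 : ∑ a ∈ S, f a = 1 := by
    rw [← Finset.sum_coe_sort S f]
    simp only [hf]
    rw [← ENNReal.ofReal_sum_of_nonneg fun i _ => hw0 i, hw1, ENNReal.ofReal_one]
  refine ⟨PMF.ofFinset f S hf1 hf0, fun a ha => ?_, ?_⟩
  · by_contra h
    exact ha (hf0 a h)
  · ext b
    rw [PMF.bind_apply]
    simp only [PMF.ofFinset_apply]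
    rw [tsum_eq_sum (s := S) fun a ha => by rw [hf0 a ha, zero_mul]]
    by_cases hb : b ∈ S
    · rw [← Finset.sum_coe_sort S fun a => f a * κ a b, hf ⟨b, hb⟩, ← hw ⟨b, hb⟩,
        ENNReal.ofReal_sum_of_nonneg fun i _ => mul_nonneg (hw0 i) ENNReal.toReal_nonneg]
      refine Finset.sum_congr rfl fun i _ => ?_
      rw [hf, ENNReal.ofReal_mul (hw0 i), ENNReal.ofReal_toReal ((κ i).apply_ne_top b)]
    · rw [hf0 b hb]
      exact Finset.sum_eq_zero fun a ha => by rw [hzero a ha b hb, mul_zero]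

namespace Network

variable {R : Network}

/-! ### Conditional expectation of a slot given its initial state -/

/-- Expectation of a function of the slot, given that the slot begins in the state `s`. -/
noncomputable def slotExpect (α : R.Policy) (s : R.State) (f : R.Slot → ℝ) : ℝ :=
  expect (R.drawLaw α s) fun d => f (s, d)

theorem slotExpect_add (α : R.Policy) (s : R.State) (f g : R.Slot → ℝ) :
    slotExpect α s (fun w => f w + g w) = slotExpect α s f + slotExpect α s g := by
  simp only [slotExpect, expect_eq_sum, mul_add, Finset.sum_add_distrib]

theorem slotExpect_sub (α : R.Policy) (s : R.State) (f g : R.Slot → ℝ) :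
    slotExpect α s (fun w => f w - g w) = slotExpect α s f - slotExpect α s g := by
  simp only [slotExpect, expect_eq_sum, mul_sub, Finset.sum_sub_distrib]

theorem slotExpect_const_mul (α : R.Policy) (s : R.State) (c : ℝ) (f : R.Slot → ℝ) :
    slotExpect α s (fun w => c * f w) = c * slotExpect α s f :=
  expect_const_mul _ _ _

theorem slotExpect_const (α : R.Policy) (s : R.State) (c : ℝ) :
    slotExpect α s (fun _ => c) = c :=
  expect_const _ _

theorem slotExpect_mono (α : R.Policy) (s : R.State) {f g : R.Slot → ℝ}
    (h : ∀ d ∈ (R.drawLaw α s).support, f (s, d) ≤ g (s, d)) :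
    slotExpect α s f ≤ slotExpect α s g := by
  obtain ⟨C, hC⟩ := exists_abs_le fun d : R.Draw => f (s, d)
  obtain ⟨D, hD⟩ := exists_abs_le fun d : R.Draw => g (s, d)
  exact expect_mono _ hC hD h

theorem abs_slotExpect_le (α : R.Policy) (s : R.State) {f : R.Slot → ℝ} {C : ℝ}
    (h : ∀ w, |f w| ≤ C) : |slotExpect α s f| ≤ C := by
  rw [abs_le]
  constructor
  · rw [← slotExpect_const α s (-C)]
    exact slotExpect_mono α s fun d _ => (abs_le.1 (h _)).1
  · rw [← slotExpect_const α s C]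
    exact slotExpect_mono α s fun d _ => (abs_le.1 (h _)).2

/-- The random choices of a slot as an iterated expectation. -/
theorem slotExpect_eq (α : R.Policy) (s : R.State) (f : R.Slot → ℝ) :
    slotExpect α s f = expect (coin (α s)) fun m => expect R.harvest fun g =>
      expect (coin R.pS) fun a => expect (coin R.pR) fun b => f (s, m, g, a, b) := by
  obtain ⟨C, hC⟩ := exists_abs_le fun d : R.Draw => f (s, d)
  simp only [slotExpect, drawLaw, expect_bind _ _ hC, expect_map _ _ hC]

theorem expect_slotLaw (α : R.Policy) (μ : PMF R.State) {f : R.Slot → ℝ} {C : ℝ}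
    (hf : ∀ w, |f w| ≤ C) :
    expect (slotLaw α μ) f = expect μ fun s => slotExpect α s f := by
  simp only [slotLaw, expect_bind _ _ hf, expect_map _ _ hf, slotExpect]

theorem expect_step (α : R.Policy) (μ : PMF R.State) {f : R.State → ℝ} {C : ℝ}
    (hf : ∀ s, |f s| ≤ C) :
    expect (step α μ) f = expect μ fun s => slotExpect α s fun w => f (Slot.next w) := by
  rw [step, expect_map _ _ hf, expect_slotLaw α μ fun w => hf _]

theorem mem_support_slotLaw {α : R.Policy} {μ : PMF R.State} {w : R.Slot} :
    w ∈ (slotLaw α μ).support ↔ w.1 ∈ μ.support ∧ w.2 ∈ (R.drawLaw α w.1).support := by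
  obtain ⟨s, d⟩ := w
  simp only [slotLaw, PMF.mem_support_bind_iff, PMF.mem_support_map_iff, Prod.mk.injEq]
  constructor
  · rintro ⟨s', hs', d', hd', rfl, rfl⟩
    exact ⟨hs', hd'⟩
  · rintro ⟨hs, hd⟩
    exact ⟨s, hs, d, hd, rfl, rfl⟩

theorem mem_support_step {α : R.Policy} {μ : PMF R.State} {s' : R.State} :
    s' ∈ (step α μ).support ↔
      ∃ s ∈ μ.support, ∃ d ∈ (R.drawLaw α s).support, Slot.next (s, d) = s' := by
  simp only [step, PMF.mem_support_map_iff, mem_support_slotLaw]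
  constructor
  · rintro ⟨⟨s, d⟩, ⟨hs, hd⟩, h⟩
    exact ⟨s, hs, d, hd, h⟩
  · rintro ⟨s, hs, d, hd, h⟩
    exact ⟨(s, d), ⟨hs, hd⟩, h⟩

theorem mode_of_mem_support_drawLaw {α : R.Policy} {s : R.State} {d : R.Draw}
    (hd : d ∈ (R.drawLaw α s).support) :
    (d.1 = true → α s ≠ 0) ∧ (d.1 = false → α s ≠ 1) := by
  simp only [drawLaw, PMF.mem_support_bind_iff, PMF.mem_support_map_iff] at hd
  obtain ⟨m, hm, g, -, a, -, b, -, rfl⟩ := hd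
  rw [PMF.mem_support_iff] at hm
  constructor
  · rintro rfl h
    simp [coin, h] at hm
  · rintro rfl h
    simp [coin, h] at hm

/-! ### Balance of packets and energy -/

theorem next_fst_eq (w : R.Slot) :
    ((Slot.next w).1 : ℝ) = Slot.qd w +
      (if Slot.decoding w = true ∧ Slot.directOK w = false then 1 else 0) -
      (if Slot.active w ∧ Slot.relayOK w = true then 1 else 0) := by
  have hmid : (Slot.midQd w : ℝ) = Slot.qd w +
      (if Slot.decoding w = true ∧ Slot.directOK w = false then 1 else 0) := by
    by_cases h : Slot.decoding w = true ∧ Slot.directOK w = false <;>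
      simp [Slot.midQd, h]
  rw [← hmid]
  by_cases ha : Slot.active w <;> by_cases hb : Slot.relayOK w = true <;>
    simp [Slot.next, ha, hb]
  rw [Nat.cast_sub ha.1, Nat.cast_one]

theorem next_snd_eq (w : R.Slot) :
    ((Slot.next w).2 : ℝ) = (Slot.qe w : ℕ) + Slot.offered w - Slot.blocked w -
      R.K * (if Slot.active w then 1 else 0) := by
  have hmid : ((Slot.midQe w : ℕ) : ℝ) =
      (Slot.qe w : ℕ) + Slot.offered w - Slot.blocked w := by
    have hq : (Slot.qe w : ℕ) ≤ R.N := Nat.lt_succ_iff.1 (Slot.qe w).2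
    have : (Slot.midQe w : ℕ) + Slot.blocked w = (Slot.qe w : ℕ) + Slot.offered w := by
      by_cases h : Slot.decoding w = true <;>
        simp [Slot.midQe, Slot.blocked, Slot.offered, h] <;> omega
    rw [eq_sub_iff_add_eq]
    exact_mod_cast this
  rw [← hmid]
  by_cases ha : Slot.active w
  · simp [Slot.next, ha, Nat.cast_sub ha.2]
  · simp [Slot.next, ha]

theorem slotExpect_stored (α : R.Policy) (s : R.State) :
    slotExpect α s (fun w => if Slot.decoding w = true ∧ Slot.directOK w = false then 1 else 0) =
      α s * (1 - R.pS) := by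
  simp [slotExpect_eq, expect_coin, expect_const, Slot.decoding, Slot.directOK]

theorem slotExpect_directOK (α : R.Policy) (s : R.State) :
    slotExpect α s (fun w => if Slot.directOK w = true then 1 else 0) = R.pS := by
  simp [slotExpect_eq, expect_coin, expect_const, Slot.directOK]

theorem slotExpect_offered (α : R.Policy) (s : R.State) :
    slotExpect α s (fun w => (Slot.offered w : ℝ)) = (1 - α s) * R.meanHarvest := by
  simp only [slotExpect_eq, Slot.offered, Slot.decoding, Slot.energy]
  rw [expect_coin]
  simp [meanHarvest, expect_const]

/-- Whether the relay is active is settled before the outcome of its transmission is drawn. -/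
theorem slotExpect_relayed (α : R.Policy) (s : R.State) :
    slotExpect α s (fun w => if Slot.active w ∧ Slot.relayOK w = true then 1 else 0) =
      R.pR * slotExpect α s (fun w => if Slot.active w then 1 else 0) := by
  have hact : ∀ m g a b b', Slot.active ((s, m, g, a, b) : R.Slot) ↔
      Slot.active ((s, m, g, a, b') : R.Slot) := fun _ _ _ _ _ => Iff.rfl
  rw [slotExpect_eq, slotExpect_eq]
  simp only [← expect_const_mul]
  refine congrArg _ (funext fun m => congrArg _ (funext fun g => congrArg _ (funext fun a => ?_)))
  rw [expect_coin, expect_coin]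
  simp only [Slot.relayOK, hact m g a true false]
  split_ifs <;> simp_all
  ring

/-- Expected drift of the data buffer. -/
theorem slotExpect_next_fst (α : R.Policy) (s : R.State) :
    slotExpect α s (fun w => ((Slot.next w).1 : ℝ)) = s.1 + α s * (1 - R.pS) -
      R.pR * slotExpect α s (fun w => if Slot.active w then 1 else 0) := by
  simp only [next_fst_eq]
  rw [slotExpect_sub, slotExpect_add, slotExpect_stored, slotExpect_relayed]
  congr 2
  exact slotExpect_const α s (s.1 : ℝ)

/-- Expected drift of the energy buffer. -/
theorem slotExpect_next_snd (α : R.Policy) (s : R.State) :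
    slotExpect α s (fun w => ((Slot.next w).2 : ℝ)) = (s.2 : ℕ) + (1 - α s) * R.meanHarvest -
      slotExpect α s (fun w => (Slot.blocked w : ℝ)) -
      R.K * slotExpect α s (fun w => if Slot.active w then 1 else 0) := by
  simp only [next_snd_eq]
  rw [slotExpect_sub, slotExpect_sub, slotExpect_add, slotExpect_offered, slotExpect_const_mul]
  congr 3
  exact slotExpect_const α s ((s.2 : ℕ) : ℝ)

theorem slotExpect_delivered (α : R.Policy) (s : R.State) :
    slotExpect α s (fun w => (Slot.delivered w : ℝ)) =
      R.pS + R.pR * slotExpect α s (fun w => if Slot.active w then 1 else 0) := by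
  rw [← slotExpect_relayed, ← slotExpect_directOK α s, ← slotExpect_add]
  simp [Slot.delivered]

theorem meanHarvest_nonneg (R : Network) : 0 ≤ R.meanHarvest :=
  tsum_nonneg fun _ => mul_nonneg ENNReal.toReal_nonneg (Nat.cast_nonneg _)

/-! ### The average-reward equation -/

/-- The denominator `E(Γ) pR + K (1 - pS)` of `α^T`. -/
noncomputable def denom (R : Network) : ℝ :=
  R.meanHarvest * (R.pR : ℝ) + (R.K : ℝ) * (1 - (R.pS : ℝ))

theorem denom_pos (hK : 1 ≤ R.K) (hpS : (R.pS : ℝ) < 1) : 0 < R.denom := by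
  have h1 := mul_nonneg R.meanHarvest_nonneg R.pR.2.1
  have h2 : (0 : ℝ) < R.K * (1 - (R.pS : ℝ)) :=
    mul_pos (by exact_mod_cast hK) (sub_pos.2 hpS)
  exact add_pos_of_nonneg_of_pos h1 h2

/-- The optimal long-run throughput `pS + pR E(Γ) (1 - pS) / (E(Γ) pR + K (1 - pS))`. -/
noncomputable def optThroughput (R : Network) : ℝ :=
  R.pS + R.pR * (R.meanHarvest * (1 - R.pS)) / R.denom

/-- The relative value of a state: a stored packet is worth `pR E(Γ) / denom` and a stored energy
unit is worth `pR (1 - pS) / denom` deliveries. -/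
noncomputable def potential (s : R.State) : ℝ :=
  R.pR * (R.meanHarvest * s.1 + (1 - R.pS) * (s.2 : ℕ)) / R.denom

theorem optThroughput_nonneg (hK : 1 ≤ R.K) (hpS : (R.pS : ℝ) < 1) : 0 ≤ R.optThroughput := by
  have := denom_pos hK hpS
  have h1 := R.meanHarvest_nonneg
  have h2 : (0 : ℝ) ≤ R.pR := R.pR.2.1
  have h3 : (0 : ℝ) ≤ R.pS := R.pS.2.1
  have h4 : (0 : ℝ) ≤ 1 - R.pS := (sub_pos.2 hpS).le
  unfold optThroughput
  positivity

theorem potential_nonneg (hK : 1 ≤ R.K) (hpS : (R.pS : ℝ) < 1) (s : R.State) :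
    0 ≤ potential s := by
  have := denom_pos hK hpS
  have h1 := R.meanHarvest_nonneg
  have h2 : (0 : ℝ) ≤ R.pR := R.pR.2.1
  have h4 : (0 : ℝ) ≤ 1 - R.pS := (sub_pos.2 hpS).le
  unfold potential
  positivity

/-- The average-reward (Poisson) equation, valid for every policy: the potential weighs packets
and energy so that neither the mode nor the activity of the relay influences the right-hand side,
and only blocked energy is lost. -/
theorem slotExpect_delivered_add_potential (hK : 1 ≤ R.K) (hpS : (R.pS : ℝ) < 1) (α : R.Policy)
    (s : R.State) :
    slotExpect α s (fun w => Slot.delivered w + potential (Slot.next w)) =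
      R.optThroughput + potential s -
        R.pR * (1 - R.pS) / R.denom * slotExpect α s (fun w => (Slot.blocked w : ℝ)) := by
  have hD := (denom_pos hK hpS).ne'
  have hpot : ∀ w : R.Slot, potential (Slot.next w) =
      R.pR * R.meanHarvest / R.denom * ((Slot.next w).1 : ℝ) +
        R.pR * (1 - R.pS) / R.denom * ((Slot.next w).2 : ℝ) := fun w => by
    unfold potential
    ring
  simp only [hpot]
  rw [slotExpect_add, slotExpect_add, slotExpect_const_mul, slotExpect_const_mul,
    slotExpect_delivered, slotExpect_next_fst, slotExpect_next_snd, optThroughput, potential]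
  field_simp
  rw [denom]
  ring

/-! ### Expected deliveries over finitely many slots -/

/-- The expected number of packets detected during the first `n` slots, started in `s`. -/
noncomputable def value (α : R.Policy) : ℕ → R.State → ℝ
  | 0, _ => 0
  | n + 1, s => slotExpect α s fun w => Slot.delivered w + value α n (Slot.next w)

theorem delivered_le_two (w : R.Slot) : Slot.delivered w ≤ 2 := by
  unfold Slot.delivered
  split_ifs <;> simp

theorem abs_delivered_le (w : R.Slot) : |(Slot.delivered w : ℝ)| ≤ 2 := by
  rw [abs_of_nonneg (Nat.cast_nonneg _)]
  exact_mod_cast delivered_le_two w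

theorem abs_value_le (α : R.Policy) (n : ℕ) (s : R.State) : |value α n s| ≤ 2 * n := by
  induction n generalizing s with
  | zero => simp [value]
  | succ n ih =>
    refine abs_slotExpect_le α s fun w => (abs_add_le _ _).trans ?_
    have h1 := abs_delivered_le w
    have h2 := ih (Slot.next w)
    push_cast
    linarith

theorem avgThroughput_eq (α : R.Policy) (μ : PMF R.State) (n : ℕ) :
    avgThroughput α μ n = expect μ (value α n) / n := by
  rw [avgThroughput]
  congr 1
  induction n generalizing μ with
  | zero => simpa [value] using (expect_const μ 0).symm
  | succ n ih =>
    have hlaw : ∀ t, law α μ (t + 1) = law α (step α μ) t := fun t =>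
      Function.iterate_succ_apply _ _ _
    have h0 : law α μ 0 = μ := rfl
    rw [Finset.sum_range_succ', h0]
    simp only [hlaw, ih, value, slotExpect_add]
    rw [expect_step α μ (abs_value_le α n), expect_slotLaw α μ abs_delivered_le,
      expect_add μ (fun s => abs_slotExpect_le α s abs_delivered_le)
        (fun s => abs_slotExpect_le α s fun w => abs_value_le α n _), add_comm]

/-- No policy gains more than the potential of the initial state over the optimal rate. -/
theorem value_le (hK : 1 ≤ R.K) (hpS : (R.pS : ℝ) < 1) (α : R.Policy) (n : ℕ) (s : R.State) :
    value α n s ≤ n * R.optThroughput + potential s := by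
  induction n generalizing s with
  | zero => simpa [value] using potential_nonneg hK hpS s
  | succ n ih =>
    have hstep : value α (n + 1) s ≤
        slotExpect α s fun w => (Slot.delivered w + potential (Slot.next w)) +
          n * R.optThroughput :=
      slotExpect_mono α s fun d _ => by linarith [ih (Slot.next (s, d))]
    rw [slotExpect_add, slotExpect_const, slotExpect_delivered_add_potential hK hpS] at hstep
    have hB : 0 ≤ slotExpect α s (fun w => (Slot.blocked w : ℝ)) := by
      rw [← slotExpect_const α s 0]
      exact slotExpect_mono α s fun d _ => Nat.cast_nonneg _
    have hc : 0 ≤ (R.pR : ℝ) * (1 - R.pS) / R.denom :=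
      div_nonneg (mul_nonneg R.pR.2.1 (sub_pos.2 hpS).le) (denom_pos hK hpS).le
    have := mul_nonneg hc hB
    push_cast
    linarith

theorem limsup_avgThroughput_le (hK : 1 ≤ R.K) (hpS : (R.pS : ℝ) < 1) (α : R.Policy)
    (μ : PMF R.State) : limsup (avgThroughput α μ) atTop ≤ R.optThroughput := by
  -- The mean of the potential may be infinite, so the bound on `value` is capped at `2`.
  let h : ℕ → R.State → ℝ := fun n s => min 2 (R.optThroughput + potential s / n)
  have hT := optThroughput_nonneg hK hpS
  have hh : ∀ n s, |h n s| ≤ 2 := fun n s => by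
    have : 0 ≤ potential s / n := div_nonneg (potential_nonneg hK hpS s) (Nat.cast_nonneg _)
    rw [abs_of_nonneg (le_min zero_le_two (by linarith))]
    exact min_le_left _ _
  have hlim : Tendsto (fun n => expect μ (h n)) atTop
      (nhds (expect μ fun _ => min 2 R.optThroughput)) := by
    refine tendsto_expect μ hh fun s => ?_
    have := (tendsto_const_div_atTop_nhds_zero_nat (potential s)).const_add R.optThroughput
    rw [add_zero] at this
    exact tendsto_const_nhds.min this
  rw [expect_const] at hlim
  have hle : ∀ᶠ n in atTop, avgThroughput α μ n ≤ expect μ (h n) := by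
    filter_upwards [eventually_gt_atTop 0] with n hn
    have hn' : (0 : ℝ) < n := by exact_mod_cast hn
    rw [avgThroughput_eq, div_eq_inv_mul, ← expect_const_mul]
    refine expect_mono μ (C := 2) (fun s => ?_) (hh n) fun s _ => ?_
    · rw [abs_mul, abs_of_pos (inv_pos.2 hn'), inv_mul_le_iff₀ hn', mul_comm]
      exact abs_value_le α n s
    · rw [inv_mul_le_iff₀ hn', mul_min_of_nonneg _ _ hn'.le]
      refine le_min ?_ ?_
      · linarith [(abs_le.1 (abs_value_le α n s)).2]
      · rw [mul_add, mul_div_cancel₀ _ hn'.ne']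
        exact value_le hK hpS α n s
  have hlow : ∀ n, 0 ≤ avgThroughput α μ n := fun n =>
    div_nonneg (Finset.sum_nonneg fun t _ => tsum_nonneg fun w =>
      mul_nonneg ENNReal.toReal_nonneg (Nat.cast_nonneg _)) (Nat.cast_nonneg _)
  calc limsup (avgThroughput α μ) atTop ≤ limsup (fun n => expect μ (h n)) atTop :=
        limsup_le_limsup hle (isBoundedUnder_of ⟨0, hlow⟩).isCoboundedUnder_le
          hlim.isBoundedUnder_le
    _ = min 2 R.optThroughput := hlim.limsup_eq
    _ ≤ R.optThroughput := min_le_right _ _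

/-! ### The threshold policy -/

/-- States with at most one packet in which, when there is one, the energy buffer has room for any
harvest. -/
def HasRoom (s : R.State) : Prop :=
  s.1 ≤ 1 ∧ (s.1 = 1 → (s.2 : ℕ) + R.bmax ≤ R.N)

theorem energy_le (w : R.Slot) : Slot.energy w ≤ R.bmax :=
  Nat.lt_succ_iff.1 w.2.2.1.2

section Threshold

variable {eth : ℤ} {α : R.Policy}

/-- The modes that the threshold policy takes with at most one packet at the relay. -/
theorem IsThresholdPolicy.mode_cases (hα : IsThresholdPolicy eth α) {s : R.State} (hs : s.1 ≤ 1)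
    {d : R.Draw} (hd : d ∈ (R.drawLaw α s).support) :
    (s.1 = 0 ∧ d.1 = true) ∨ (s.1 = 0 ∧ d.1 = false ∧ ((s.2 : ℕ) : ℤ) < eth) ∨
      (s.1 = 1 ∧ d.1 = false) := by
  obtain ⟨q, e⟩ := s
  obtain ⟨h1, h2⟩ := mode_of_mem_support_drawLaw hd
  obtain ⟨hge, -, hone⟩ := hα
  cases hm : d.1
  · obtain rfl | rfl : q = 0 ∨ q = 1 := by
      change q ≤ 1 at hs
      omega
    · exact Or.inr (Or.inl ⟨rfl, rfl, not_le.1 fun h => h2 hm (hge e h)⟩)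
    · exact Or.inr (Or.inr ⟨rfl, rfl⟩)
  · obtain rfl | rfl : q = 0 ∨ q = 1 := by
      change q ≤ 1 at hs
      omega
    · exact Or.inl ⟨rfl, rfl⟩
    · exact absurd (hone e) (h1 hm)

/-- After a single slot the energy buffer has room for the harvest of the next EH slot: a relay
that keeps a packet either has just spent `K ≥ bmax` units or holds fewer than `K` of them. -/
theorem IsThresholdPolicy.hasRoom_next (hα : IsThresholdPolicy eth α) (hbmax : R.bmax ≤ R.K)
    (hN : 2 * R.K ≤ R.N) {s : R.State} (hs : s.1 ≤ 1) {d : R.Draw}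
    (hd : d ∈ (R.drawLaw α s).support) : HasRoom (Slot.next (s, d)) := by
  have hmq : Slot.midQd (s, d) ≤ 1 := by
    obtain ⟨h0, -⟩ | ⟨h0, hm, -⟩ | ⟨h0, hm⟩ := hα.mode_cases hs hd
    · unfold Slot.midQd Slot.qd
      split_ifs <;> simp [h0]
    · simp [Slot.midQd, Slot.qd, Slot.decoding, h0, hm]
    · simp [Slot.midQd, Slot.qd, Slot.decoding, h0, hm]
  have hme : (Slot.midQe (s, d) : ℕ) ≤ R.N := Nat.lt_succ_iff.1 (Slot.midQe (s, d)).2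
  by_cases ha : Slot.active (s, d)
  · have hK := ha.2
    rw [Slot.next, if_pos ha]
    refine ⟨?_, fun _ => ?_⟩
    · dsimp only
      split_ifs <;> omega
    · dsimp only
      omega
  · rw [Slot.next, if_neg ha]
    refine ⟨hmq, fun h => ?_⟩
    have hlt : (Slot.midQe (s, d) : ℕ) < R.K := not_le.1 fun hK => ha ⟨h.ge, hK⟩
    dsimp only
    omega

theorem IsThresholdPolicy.blocked_eq_zero (hα : IsThresholdPolicy eth α)
    (heth : eth ≤ (R.N : ℤ) - (R.bmax : ℤ) + 1) {s : R.State} (hs : HasRoom s) {d : R.Draw}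
    (hd : d ∈ (R.drawLaw α s).support) : Slot.blocked (s, d) = 0 := by
  have hg : Slot.energy (s, d) ≤ R.bmax := energy_le _
  have he : (s.2 : ℕ) ≤ R.N := Nat.lt_succ_iff.1 s.2.2
  rw [Slot.blocked, Nat.sub_eq_zero_iff_le]
  obtain ⟨-, hm⟩ | ⟨-, hm, hlt⟩ | ⟨h1, hm⟩ := hα.mode_cases hs.1 hd
  · simpa [Slot.offered, Slot.decoding, Slot.qe, hm] using he
  · simp only [Slot.offered, Slot.decoding, Slot.qe, hm]
    simp only [Bool.false_eq_true, if_false]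
    omega
  · have := hs.2 h1
    simp only [Slot.offered, Slot.decoding, Slot.qe, hm]
    simp only [Bool.false_eq_true, if_false]
    omega

theorem IsThresholdPolicy.hasRoom_of_mem_support_step (hα : IsThresholdPolicy eth α)
    (hbmax : R.bmax ≤ R.K) (hN : 2 * R.K ≤ R.N) {μ : PMF R.State} (hμ : AtMost 1 μ) {s : R.State}
    (hs : s ∈ (step α μ).support) : HasRoom s := by
  obtain ⟨s', hs', d, hd, rfl⟩ := mem_support_step.1 hs
  exact hα.hasRoom_next hbmax hN (hμ s' hs') hd

theorem IsThresholdPolicy.hasRoom_of_mem_support_law (hα : IsThresholdPolicy eth α)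
    (hbmax : R.bmax ≤ R.K) (hN : 2 * R.K ≤ R.N) {μ : PMF R.State}
    (hμ : ∀ s ∈ μ.support, HasRoom s) (t : ℕ) : ∀ s ∈ (law α μ t).support, HasRoom s := by
  induction t with
  | zero => exact hμ
  | succ t ih =>
    rw [law, Function.iterate_succ_apply']
    exact fun s hs => hα.hasRoom_of_mem_support_step hbmax hN (fun s hs => (ih s hs).1) hs

theorem IsThresholdPolicy.atMost_law (hα : IsThresholdPolicy eth α)
    (hbmax : R.bmax ≤ R.K) (hN : 2 * R.K ≤ R.N) {μ : PMF R.State} (hμ : AtMost 1 μ) (t : ℕ) :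
    AtMost 1 (law α μ t) := by
  induction t with
  | zero => exact hμ
  | succ t ih =>
    rw [law, Function.iterate_succ_apply']
    exact fun s hs => (hα.hasRoom_of_mem_support_step hbmax hN ih hs).1

/-! ### Optimality of the threshold policy -/

theorem potential_le (hK : 1 ≤ R.K) (hpS : (R.pS : ℝ) < 1) {s : R.State} (hs : s.1 ≤ 1) :
    potential s ≤ R.pR * (R.meanHarvest + (1 - R.pS) * R.N) / R.denom := by
  have h1 : (s.1 : ℝ) ≤ 1 := by exact_mod_cast hs
  have h2 : ((s.2 : ℕ) : ℝ) ≤ R.N := by exact_mod_cast Nat.lt_succ_iff.1 s.2.2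
  have h3 : R.meanHarvest * s.1 ≤ R.meanHarvest := mul_le_of_le_one_right R.meanHarvest_nonneg h1
  have h4 : (1 - (R.pS : ℝ)) * (s.2 : ℕ) ≤ (1 - R.pS) * R.N :=
    mul_le_mul_of_nonneg_left h2 (sub_pos.2 hpS).le
  exact div_le_div_of_nonneg_right
    (mul_le_mul_of_nonneg_left (add_le_add h3 h4) R.pR.2.1) (denom_pos hK hpS).le

/-- Without blocking the average-reward equation is exact, so that the threshold policy loses at
most a constant against the optimal rate. -/
theorem IsThresholdPolicy.le_value_of_hasRoom (hα : IsThresholdPolicy eth α) (hK : 1 ≤ R.K)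
    (hbmax : R.bmax ≤ R.K) (hN : 2 * R.K ≤ R.N) (hpS : (R.pS : ℝ) < 1)
    (heth : eth ≤ (R.N : ℤ) - (R.bmax : ℤ) + 1) (n : ℕ) {s : R.State} (hs : HasRoom s) :
    n * R.optThroughput + potential s -
      R.pR * (R.meanHarvest + (1 - R.pS) * R.N) / R.denom ≤ value α n s := by
  induction n generalizing s with
  | zero =>
    have := potential_le hK hpS hs.1
    simp only [value, Nat.cast_zero, zero_mul, zero_add]
    linarith
  | succ n ih =>
    have hstep : slotExpect α s (fun w => (Slot.delivered w + potential (Slot.next w)) +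
        (n * R.optThroughput - R.pR * (R.meanHarvest + (1 - R.pS) * R.N) / R.denom)) ≤
        value α (n + 1) s :=
      slotExpect_mono α s fun d hd => by
        linarith [ih (hα.hasRoom_next hbmax hN hs.1 hd)]
    have hB : slotExpect α s (fun w => (Slot.blocked w : ℝ)) = 0 := by
      rw [← slotExpect_const α s 0]
      exact expect_congr _ fun d hd => by simp [hα.blocked_eq_zero heth hs hd]
    rw [slotExpect_add, slotExpect_const, slotExpect_delivered_add_potential hK hpS, hB] at hstep
    push_cast
    linarith

theorem IsThresholdPolicy.exists_le_value (hα : IsThresholdPolicy eth α) (hK : 1 ≤ R.K)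
    (hbmax : R.bmax ≤ R.K) (hN : 2 * R.K ≤ R.N) (hpS : (R.pS : ℝ) < 1)
    (heth : eth ≤ (R.N : ℤ) - (R.bmax : ℤ) + 1) :
    ∃ C : ℝ, ∀ (n : ℕ) (s : R.State), s.1 ≤ 1 → n * R.optThroughput - C ≤ value α n s := by
  refine ⟨R.optThroughput + R.pR * (R.meanHarvest + (1 - R.pS) * R.N) / R.denom,
    fun n s hs => ?_⟩
  have hT := optThroughput_nonneg hK hpS
  cases n with
  | zero =>
    have h := (potential_nonneg hK hpS s).trans (potential_le hK hpS hs)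
    simp only [value, Nat.cast_zero, zero_mul]
    linarith
  | succ n =>
    -- The first slot may waste energy, but from the second one on the buffer has room.
    rw [← slotExpect_const α s (((n + 1 : ℕ) : ℝ) * R.optThroughput - _)]
    refine slotExpect_mono α s fun d hd => ?_
    have h1 := hα.le_value_of_hasRoom hK hbmax hN hpS heth n (hα.hasRoom_next hbmax hN hs hd)
    have h2 := potential_nonneg hK hpS (Slot.next (s, d))
    have h3 : (0 : ℝ) ≤ Slot.delivered (s, d) := Nat.cast_nonneg _
    push_cast
    linarith

theorem IsThresholdPolicy.le_liminf_avgThroughput (hα : IsThresholdPolicy eth α) (hK : 1 ≤ R.K)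
    (hbmax : R.bmax ≤ R.K) (hN : 2 * R.K ≤ R.N) (hpS : (R.pS : ℝ) < 1)
    (heth : eth ≤ (R.N : ℤ) - (R.bmax : ℤ) + 1) {μ : PMF R.State} (hμ : AtMost 1 μ) :
    R.optThroughput ≤ liminf (avgThroughput α μ) atTop := by
  obtain ⟨C, hC⟩ := hα.exists_le_value hK hbmax hN hpS heth
  have hlim : Tendsto (fun n : ℕ => R.optThroughput - C / n) atTop (nhds R.optThroughput) := by
    simpa using (tendsto_const_div_atTop_nhds_zero_nat C).const_sub R.optThroughput
  have hle : ∀ᶠ n : ℕ in atTop, R.optThroughput - C / n ≤ avgThroughput α μ n := by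
    filter_upwards [eventually_gt_atTop 0] with n hn
    have hn' : (0 : ℝ) < n := by exact_mod_cast hn
    rw [avgThroughput_eq, le_div_iff₀ hn', sub_mul, div_mul_cancel₀ _ hn'.ne', mul_comm,
      ← expect_const μ ((n : ℝ) * R.optThroughput - C)]
    exact expect_mono μ (fun _ => le_rfl) (abs_value_le α n) fun s hs => hC n s (hμ s hs)
  have hup : ∀ n, avgThroughput α μ n ≤ 2 := fun n => by
    rw [avgThroughput_eq]
    refine div_le_of_le_mul₀ (Nat.cast_nonneg _) zero_le_two ?_
    rw [← expect_const μ ((2 : ℝ) * n)]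
    exact expect_mono μ (abs_value_le α n) (fun _ => le_rfl) fun s _ =>
      (abs_le.1 (abs_value_le α n s)).2
  calc R.optThroughput = liminf (fun n : ℕ => R.optThroughput - C / n) atTop :=
        hlim.liminf_eq.symm
    _ ≤ liminf (avgThroughput α μ) atTop :=
        liminf_le_liminf hle hlim.isBoundedUnder_ge (isBoundedUnder_of ⟨2, hup⟩).isCoboundedUnder_ge

/-! ### The stationary regime -/

theorem IsThresholdPolicy.exists_isStationary (hα : IsThresholdPolicy eth α)
    (hbmax : R.bmax ≤ R.K) (hN : 2 * R.K ≤ R.N) :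
    ∃ μ : PMF R.State, AtMost 1 μ ∧ IsStationary α μ := by
  let κ : R.State → PMF R.State := fun s => (R.drawLaw α s).map fun d => Slot.next (s, d)
  obtain ⟨μ, hμ, hfix⟩ := exists_stationary_of_finset κ
    (Finset.range 2 ×ˢ (Finset.univ : Finset (Fin (R.N + 1)))) ⟨(0, 0), by simp⟩ fun s hs b hb => by
      obtain ⟨d, hd, rfl⟩ := (PMF.mem_support_map_iff _ _ _).1 hb
      have hs1 : s.1 ≤ 1 := by simpa [Nat.lt_succ_iff] using hs
      simpa [Nat.lt_succ_iff] using (hα.hasRoom_next hbmax hN hs1 hd).1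
  refine ⟨μ, fun s hs => by simpa [Nat.lt_succ_iff] using hμ s hs, ?_⟩
  rw [IsStationary, step, slotLaw, PMF.map_bind]
  simp only [PMF.map_comp]
  exact hfix

/-- In a stationary regime without blocking, the weighted content `K q_d - pR q_e` of the two
buffers is balanced. An active relay does not change it on average, so that only the decoding
probability is left in the balance equation. -/
theorem avgDecoding_eq_alphaT (hK : 1 ≤ R.K) (hpS : (R.pS : ℝ) < 1) {μ : PMF R.State}
    (hμ : AtMost 1 μ) (hst : IsStationary α μ)
    (hB : ∀ w ∈ (slotLaw α μ).support, Slot.blocked w = 0) : avgDecoding α μ = R.alphaT := by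
  -- The packet count is capped at `1`, which makes the weighted content bounded.
  let f : R.State → ℝ := fun s => R.K * ((min s.1 1 : ℕ) : ℝ) - R.pR * (s.2 : ℕ)
  have hf : ∀ s, |f s| ≤ R.K + R.N := fun s => by
    have h1 : ((min s.1 1 : ℕ) : ℝ) ≤ 1 := by exact_mod_cast min_le_right _ _
    have h2 : ((s.2 : ℕ) : ℝ) ≤ R.N := by exact_mod_cast Nat.lt_succ_iff.1 s.2.2
    have h3 : R.K * ((min s.1 1 : ℕ) : ℝ) ≤ R.K := mul_le_of_le_one_right (Nat.cast_nonneg _) h1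
    have h4 : R.pR * ((s.2 : ℕ) : ℝ) ≤ R.N :=
      (mul_le_of_le_one_left (Nat.cast_nonneg _) R.pR.2.2).trans h2
    have h5 : 0 ≤ R.K * ((min s.1 1 : ℕ) : ℝ) := by positivity
    have h6 : 0 ≤ R.pR * ((s.2 : ℕ) : ℝ) := mul_nonneg R.pR.2.1 (Nat.cast_nonneg _)
    rw [abs_le]
    constructor <;> simp only [f] <;> linarith
  have hα1 : ∀ s, |(α s : ℝ)| ≤ 1 := fun s => by
    rw [abs_of_nonneg (α s).2.1]
    exact (α s).2.2
  have hdrift : ∀ s ∈ μ.support, (slotExpect α s fun w => f (Slot.next w)) =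
      f s + (R.denom * α s + -(R.meanHarvest * R.pR)) := fun s hs => by
    have hnext : (slotExpect α s fun w => f (Slot.next w)) = slotExpect α s fun w =>
        R.K * ((Slot.next w).1 : ℝ) - R.pR * ((Slot.next w).2 : ℕ) :=
      expect_congr _ fun d hd => by
        have : (Slot.next (s, d)).1 ≤ 1 :=
          hμ _ (hst ▸ mem_support_step.2 ⟨s, hs, d, hd, rfl⟩)
        simp only [f, min_eq_left this]
    have hblk : slotExpect α s (fun w => (Slot.blocked w : ℝ)) = 0 := by
      rw [← slotExpect_const α s 0]
      exact expect_congr _ fun d hd => by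
        simp [hB (s, d) (mem_support_slotLaw.2 ⟨hs, hd⟩)]
    rw [hnext, slotExpect_sub, slotExpect_const_mul, slotExpect_const_mul, slotExpect_next_fst,
      slotExpect_next_snd, hblk]
    simp only [f, min_eq_left (hμ s hs), denom]
    ring
  have hlin : ∀ s, |R.denom * α s + -(R.meanHarvest * R.pR)| ≤
      |R.denom| + |R.meanHarvest * R.pR| := fun s => by
    refine (abs_add_le _ _).trans (add_le_add ?_ (abs_neg _).le)
    rw [abs_mul]
    exact mul_le_of_le_one_right (abs_nonneg _) (hα1 s)
  have hbal : expect μ f = expect μ f + (R.denom * avgDecoding α μ + -(R.meanHarvest * R.pR)) := by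
    conv_lhs => rw [← (show step α μ = μ from hst)]
    have hmul : ∀ s, |R.denom * (α s : ℝ)| ≤ |R.denom| := fun s => by
      rw [abs_mul]
      exact mul_le_of_le_one_right (abs_nonneg _) (hα1 s)
    rw [expect_step α μ hf, expect_congr μ hdrift, expect_add μ hf hlin,
      expect_add μ hmul (fun _ => le_rfl), expect_const_mul, expect_const, avgDecoding]
  rw [alphaT, ← denom, eq_div_iff (denom_pos hK hpS).ne']
  linarith

end Threshold

end Network

end Relay

theorem proposition2 (R : Relay.Network)
    (hK : 1 ≤ R.K) (hbmax : R.bmax ≤ R.K) (hN : 2 * R.K ≤ R.N)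
    (hpS : (R.pS : ℝ) < 1)
    (eth : ℤ) (heth : eth ≤ (R.N : ℤ) - (R.bmax : ℤ) + 1)
    (α : R.Policy) (hα : Relay.Network.IsThresholdPolicy eth α) :
    -- at most one packet is ever kept at the relay, and the policy is throughput-optimal
    (∀ μ : PMF R.State, Relay.Network.AtMost 1 μ →
      (∀ t : ℕ, Relay.Network.AtMost 1 (Relay.Network.law α μ t)) ∧
      Relay.Network.IsThroughputOptimal α μ) ∧
    -- from an empty data buffer, no energy unit is ever blocked
    (∀ μ : PMF R.State, Relay.Network.AtMost 0 μ →
      ∀ t : ℕ, ∀ w ∈ (Relay.Network.slotLaw α (Relay.Network.law α μ t)).support,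
        Relay.Network.Slot.blocked w = 0) ∧
    -- in the stationary regime, no energy unit is blocked, the blocking probability is zero,
    -- and the average decoding probability is `α^T`
    (∃ μ : PMF R.State, Relay.Network.AtMost 1 μ ∧ Relay.Network.IsStationary α μ) ∧
    (∀ μ : PMF R.State, Relay.Network.AtMost 1 μ → Relay.Network.IsStationary α μ →
      (∀ w ∈ (Relay.Network.slotLaw α μ).support, Relay.Network.Slot.blocked w = 0) ∧
      Relay.Network.blockingProb α μ = 0 ∧
      Relay.Network.avgDecoding α μ = R.alphaT) := by
  have hroom : ∀ μ : PMF R.State, (∀ s ∈ μ.support, Relay.Network.HasRoom s) →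
      ∀ w ∈ (Relay.Network.slotLaw α μ).support, Relay.Network.Slot.blocked w = 0 := by
    intro μ hμ w hw
    obtain ⟨h1, h2⟩ := Relay.Network.mem_support_slotLaw.1 hw
    exact hα.blocked_eq_zero heth (hμ w.1 h1) h2
  refine ⟨fun μ hμ => ⟨hα.atMost_law hbmax hN hμ, fun α' μ' => ?_⟩, fun μ hμ t => ?_,
    hα.exists_isStationary hbmax hN, fun μ hμ hst => ?_⟩
  · exact (Relay.Network.limsup_avgThroughput_le hK hpS α' μ').trans
      (hα.le_liminf_avgThroughput hK hbmax hN hpS heth hμ)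
  · refine hroom _ (hα.hasRoom_of_mem_support_law hbmax hN (fun s hs => ?_) t)
    have := hμ s hs
    exact ⟨by omega, fun h => by omega⟩
  · have hB := hroom μ fun s hs =>
      hα.hasRoom_of_mem_support_step hbmax hN hμ (show s ∈ (Relay.Network.step α μ).support by
        rwa [show Relay.Network.step α μ = μ from hst])
    refine ⟨hB, ?_, Relay.Network.avgDecoding_eq_alphaT hK hpS hμ hst hB⟩
    have hzero : (Relay.expect (Relay.Network.slotLaw α μ) fun w =>
        (Relay.Network.Slot.blocked w : ℝ)) = 0 := by
      rw [← Relay.expect_const (Relay.Network.slotLaw α μ) 0]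
      exact Relay.expect_congr _ fun w hw => by simp [hB w hw]
    rw [Relay.Network.blockingProb, hzero, zero_div]
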